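/- Let $\mathbb{R}^\infty$ be the set of all finite tuples of real numbers. A BSS program is a finite list of instructions, with finitely many real parameters, acting on a bi-infinite tape of cells, each blank or holding one real number: it can write a parameter into a cell, copy or delete the content of a cell, add, subtract, multiply or divide the contents of cells (an operation on a blank cell, and a division by $0$, have no result, and the machine then hangs without halting), move the head, jump, and fork according to whether the content of a cell is $=0$, $<0$, $>0$, or blank. An oracle BSS program with oracle $C\subseteq\mathbb{R}^\infty$ can moreover fork according to whether the tuple standing on the tape at the head lies in $C$. For $B,C\subseteq\mathbb{R}^\infty$ write $B\leq_{BSS}C$ ($B$ is BSS-reducible to $C$) if some oracle BSS program with oracle $C$ computes the characteristic function of $B$ on $\mathbb{R}^\infty$. Let $\mathbb{H}\subseteq\mathbb{R}^\infty$ be the BSS halting problem, that is, the set of all tuples $\langle p,x\rangle$ such that $p\in\mathbb{R}^\infty$ is the code of a BSS program (without oracle) that halts on the input $x\in\mathbb{R}^\infty$; a program is coded by the number of its instructions followed by the five-number codes of the instructions, with every parameter coded by itself, and $\langle p,x\rangle$ is the concatenation of $p$ and $x$. **Theorem.** Let $C\subseteq\mathbb{R}^\infty$ be a set such that $\mathbb{H}\leq_{BSS}C$.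 Then $|C|=2^{\aleph_0}$ and $|\mathbb{R}^\infty\setminus C|=2^{\aleph_0}$, and if $C\subseteq\mathbb{R}^m$ for some $m\in\mathbb{N}$, then also $|\mathbb{R}^m\setminus C|=2^{\aleph_0}$. In particular, $\mathbb{H}\not\leq_{BSS}C$ for every countable set $C\subseteq\mathbb{R}^\infty$, and $\mathbb{H}\not\leq_{BSS}\mathbb{A}$, where $\mathbb{A}\subseteq\mathbb{R}$ is the set of real numbers that are algebraic over $\mathbb{Q}$, regarded as a set of one-element tuples. -/

import Mathlib

namespace BSS

/-- `ℝ^∞`: all finite tuples of real numbers. -/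
abbrev Tuple : Type := List ℝ

/-- The field operations. -/
inductive FieldOp where
  | add
  | sub
  | mul
  | div

/-- The conditions on the content of one cell on which a program can fork:
it is a real number equal to, less than or greater than `0`, or it is blank. -/
inductive CellTest where
  | eqZero
  | ltZero
  | gtZero
  | isBlank

/-- Instructions of (oracle) BSS machines. Cells are addressed by integers relative to the
head; `q` is a line number of the program. Real parameters enter through `const`. -/
inductive Instr where
  /-- write the real parameter `r` into cell `i` -/
  | const (i : ℤ) (r : ℝ)
  /-- copy the content of cell `j` into cell `i` -/
  | copy (i j : ℤ)
  /-- delete the content of cell `i` -/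
  | delete (i : ℤ)
  /-- write (cell `j`) `op` (cell `k`) into cell `i` -/
  | arith (op : FieldOp) (i j k : ℤ)
  /-- move the head by `d` cells -/
  | shift (d : ℤ)
  /-- go to line `q` if cell `i` passes the test, otherwise to the next line -/
  | fork (test : CellTest) (i : ℤ) (q : ℕ)
  /-- go to line `q` -/
  | jump (q : ℕ)
  /-- go to line `q` if the tuple on the tape at the head lies in the oracle set,
  otherwise to the next line -/
  | query (q : ℕ)

/-- A program is a finite list of instructions, with lines numbered from `0`. -/
abbrev Program : Type := List Instr

/-- The cells of the machine, indexed relative to the head; `none` is a blank cell. -/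
abbrev Tape : Type := ℤ → Option ℝ

/-- The tape that holds exactly the tuple `x`, in the cells `0, …, x.length - 1`. -/
def Tape.ofTuple (x : Tuple) : Tape :=
  fun i => if 0 ≤ i then x[i.toNat]? else none

/-- `v` is the tuple on the tape at the head: the contents of the cells `0, 1, 2, …`
up to the first blank cell. -/
def Tape.Holds (t : Tape) (v : Tuple) : Prop :=
  ∀ n : ℕ, n ≤ v.length → t (n : ℤ) = v[n]?

/-- Current line of the program and content of the cells. -/
structure Config where
  line : ℕ
  tape : Tape

/-- The start of the run on input `x`. -/
def Config.start (x : Tuple) : Config := ⟨0, Tape.ofTuple x⟩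

/-- Field operations on reals; division by zero is undefined. -/
noncomputable def FieldOp.eval : FieldOp → ℝ → ℝ → Option ℝ
  | .add, a, b => some (a + b)
  | .sub, a, b => some (a - b)
  | .mul, a, b => some (a * b)
  | .div, a, b => if b = 0 then none else some (a / b)

def CellTest.Passes : CellTest → Option ℝ → Prop
  | .eqZero, some a => a = 0
  | .ltZero, some a => a < 0
  | .gtZero, some a => 0 < a
  | .isBlank, none => True
  | _, _ => False

open Classical in
/-- Execution of one instruction with oracle set `C`. There is no next configuration
(the machine hangs without halting) if an arithmetic instruction divides by zero
or has a blank cell as an operand. -/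
noncomputable def Instr.exec (C : Set Tuple) : Instr → Config → Option Config
  | .const i r, c => some ⟨c.line + 1, Function.update c.tape i (some r)⟩
  | .copy i j, c => some ⟨c.line + 1, Function.update c.tape i (c.tape j)⟩
  | .delete i, c => some ⟨c.line + 1, Function.update c.tape i none⟩
  | .arith op i j k, c =>
      match c.tape j, c.tape k with
      | some a, some b =>
          (op.eval a b).map fun r => ⟨c.line + 1, Function.update c.tape i (some r)⟩
      | _, _ => none
  | .shift d, c => some ⟨c.line + 1, fun i => c.tape (i + d)⟩
  | .fork test i q, c => some ⟨if test.Passes (c.tape i) then q else c.line + 1, c.tape⟩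
  | .jump q, c => some ⟨q, c.tape⟩
  | .query q, c => some ⟨if ∃ v ∈ C, c.tape.Holds v then q else c.line + 1, c.tape⟩

/-- `c'` is the configuration that follows `c` in a run of the program `P` with oracle `C`. -/
def Step (C : Set Tuple) (P : Program) (c c' : Config) : Prop :=
  ∃ I : Instr, P[c.line]? = some I ∧ I.exec C c = some c'

/-- The run of `P` with oracle `C` on input `x` arrives, after finitely many steps, at the
configuration `c`, and halts there because the program has no line with that number. -/
def HaltsIn (C : Set Tuple) (P : Program) (x : Tuple) (c : Config) : Prop :=
  Relation.ReflTransGen (Step C P) (Config.start x) c ∧ P.length ≤ c.line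

/-- `P` with oracle `C` halts on input `x` with output `y`. -/
def Outputs (C : Set Tuple) (P : Program) (x y : Tuple) : Prop :=
  ∃ c : Config, HaltsIn C P x c ∧ c.tape.Holds y

/-- `P` with oracle `C` computes the characteristic function of `B`. -/
def Decides (C : Set Tuple) (P : Program) (B : Set Tuple) : Prop :=
  ∀ x : Tuple, (x ∈ B → Outputs C P x [1]) ∧ (x ∉ B → Outputs C P x [0])

/-- `B` is BSS-reducible to `C`. -/
def Reducible (B C : Set Tuple) : Prop :=
  ∃ P : Program, Decides C P B

/-- The programs of ordinary BSS machines: those without oracle queries. -/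
def Program.IsOracleFree (P : Program) : Prop :=
  ∀ q : ℕ, Instr.query q ∉ P

/-- An ordinary BSS program halts on input `x`. Without queries the oracle set plays no role,
so it is taken to be empty. -/
def Halts (P : Program) (x : Tuple) : Prop :=
  ∃ c : Config, HaltsIn ∅ P x c

def FieldOp.code : FieldOp → ℝ
  | .add => 0
  | .sub => 1
  | .mul => 2
  | .div => 3

def CellTest.code : CellTest → ℝ
  | .eqZero => 0
  | .ltZero => 1
  | .gtZero => 2
  | .isBlank => 3

/-- An instruction is coded by five real numbers, the first of which is its kind;
integers and line numbers are coded by themselves, and so are real parameters. -/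
def Instr.code : Instr → Tuple
  | .const i r => [0, (i : ℝ), r, 0, 0]
  | .copy i j => [1, (i : ℝ), (j : ℝ), 0, 0]
  | .delete i => [2, (i : ℝ), 0, 0, 0]
  | .arith op i j k => [3, op.code, (i : ℝ), (j : ℝ), (k : ℝ)]
  | .shift d => [4, (d : ℝ), 0, 0, 0]
  | .fork test i q => [5, test.code, (i : ℝ), (q : ℝ), 0]
  | .jump q => [6, (q : ℝ), 0, 0, 0]
  | .query q => [7, (q : ℝ), 0, 0, 0]

/-- The code of a program: its number of instructions, followed by their codes. -/
def Program.code (P : Program) : Tuple :=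
  (P.length : ℝ) :: P.flatMap Instr.code

/-- The tuple `⟨p, x⟩` for the code `p` of `P` and the input `x`. -/
def codePair (P : Program) (x : Tuple) : Tuple := P.code ++ x

/-- The halting problem for BSS computation on `ℝ`: all `⟨p, x⟩` such that `p` is the code of an
ordinary BSS program that halts on input `x`. -/
def haltingProblem : Set Tuple :=
  {w | ∃ (P : Program) (x : Tuple), P.IsOracleFree ∧ Halts P x ∧ w = codePair P x}

/-- The set `𝔸` of real numbers algebraic over `ℚ`, as a set of one-element tuples. -/
def algebraicReals : Set Tuple :=
  {v | ∃ a : ℝ, IsAlgebraic ℚ a ∧ v = [a]}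

theorem FieldOp.code_injective : Function.Injective FieldOp.code := by
  intro a b h
  cases a <;> cases b <;> first | rfl | (norm_num [FieldOp.code] at h)

theorem CellTest.code_injective : Function.Injective CellTest.code := by
  intro a b h
  cases a <;> cases b <;> first | rfl | (norm_num [CellTest.code] at h)

theorem Instr.code_injective : Function.Injective Instr.code := by
  intro a b h
  cases a <;> cases b <;>
    simp_all [Instr.code, FieldOp.code_injective.eq_iff, CellTest.code_injective.eq_iff]

theorem Instr.length_code (I : Instr) : I.code.length = 5 := by
  cases I <;> rfl

/-- A tuple codes at most one pair of a program and an input. -/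
theorem codePair_injective {P Q : Program} {x y : Tuple}
    (h : codePair P x = codePair Q y) : P = Q ∧ x = y := by
  simp only [codePair, Program.code, List.cons_append, List.cons.injEq, Nat.cast_inj] at h
  obtain ⟨hl, h⟩ := h
  induction P generalizing Q with
  | nil =>
    cases Q with
    | nil => exact ⟨rfl, by simpa using h⟩
    | cons J Q => simp at hl
  | cons I P ih =>
    cases Q with
    | nil => simp at hl
    | cons J Q =>
      simp only [List.flatMap_cons, List.append_assoc] at h
      obtain ⟨h1, h2⟩ := List.append_inj h (by rw [I.length_code, J.length_code])
      obtain ⟨h3, h4⟩ := ih (by simpa using hl) h2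
      exact ⟨by rw [Instr.code_injective h1, h3], h4⟩

end BSS

/-! Suppose that a program decides `haltingProblem` with an oracle whose membership depends only on
length and on membership in a set `D` with fewer than continuum many elements. The entries of tuples
in `D`, the parameters of the decider and the code of `searchProgram` generate a field `F` smaller
than the continuum. Hence there are `x` in `(0, 1)` transcendental over `F` and `y > 0`
transcendental over `F(x)`. Then `searchProgram` halts on every `(x, n * x ^ k)` but not on `(x,
y)`, although the numbers `⌊y / x ^ k⌋ * x ^ k` tend to `y`.

The decider's run at `(x, y)` is finite, and its cells hold rational functions over `F` of the two
coordinates. For large `k` the run at the approximating point takes the same path. Sign tests agree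
by continuity, and a function that vanishes at the generic point vanishes identically.

Oracle queries are the crux (`eventually_query_iff`). A function with value in `F` at `(x, y)` is
constant. One with value outside `F` must also avoid `F` along the sequence, and continuity cannot
give this, since `F` is dense. Degrees do: once `k` exceeds the relevant degrees in `X`, the
substitution `Y = n * X ^ k` kills no nonzero polynomial, so a value in `F` would force the function
to be constant (`eventually_notMem`).

The decider therefore answers `0` on inputs where `searchProgram` halts
(`not_reducible_haltingProblem`). The theorem follows with `D` equal to `C`, to its complement, or
to its complement within one length. -/

namespace BSS

open Polynomial Filter Topology

/-! ### Transcendental numbers over small fields, and polynomials in two variables. -/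

theorem exists_transcendental_mem_Ioo (K : Subfield ℝ) (hK : Cardinal.mk K < Cardinal.continuum) :
    ∃ t ∈ Set.Ioo (0 : ℝ) 1, Transcendental K t := by
  by_contra! h
  have hle : Cardinal.mk (Set.Ioo (0 : ℝ) 1) ≤ Cardinal.mk {x : ℝ // IsAlgebraic K x} :=
    Cardinal.mk_le_mk_of_subset (t := {x : ℝ | IsAlgebraic K x})
      fun t ht => not_not.1 (h t ht)
  rw [Cardinal.mk_Ioo_real one_pos] at hle
  exact absurd (hle.trans (Algebraic.cardinalMk_le_max K ℝ))
    (max_lt hK Cardinal.aleph0_lt_continuum).not_ge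

theorem mk_subfieldClosure_lt {s : Set ℝ} (hs : Cardinal.mk s < Cardinal.continuum) :
    Cardinal.mk (Subfield.closure s) < Cardinal.continuum :=
  (Subfield.cardinalMk_closure_le_max s).trans_lt (max_lt hs Cardinal.aleph0_lt_continuum)

variable {F : Subfield ℝ} {x y : ℝ}

/-- Evaluation of a polynomial in two variables with coefficients in `F`, the inner variable
at `x` and the outer one at `y`. -/
noncomputable def evalAt (F : Subfield ℝ) (x y : ℝ) : F[X][X] →+* ℝ :=
  eval₂RingHom (aeval x : F[X] →ₐ[F] ℝ).toRingHom y

theorem evalAt_C_C (c : F) : evalAt F x y (C (C c)) = c := by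
  simp [evalAt]
  rfl

theorem evalAt_C_X : evalAt F x y (C X) = x := by simp [evalAt]

theorem evalAt_X : evalAt F x y X = y := by simp [evalAt]

theorem evalAt_aeval (P : F[X][X]) (q : F[X]) :
    evalAt F x (aeval x q) P = aeval x (P.eval q) := by
  simpa [evalAt] using (eval₂_at_apply (p := P) (aeval x : F[X] →ₐ[F] ℝ).toRingHom q)

theorem continuous_evalAt (P : F[X][X]) : Continuous fun y => evalAt F x y P := by
  simp only [evalAt, coe_eval₂RingHom, eval₂_eq_eval_map]
  exact Polynomial.continuous _

/-- Substituting `x` into the coefficients is injective because `x` is transcendental over `F`; a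
nonzero polynomial over `F(x)` remains, and it cannot vanish at `y`. -/
theorem evalAt_ne_zero (hx : Transcendental F x)
    (hy : Transcendental (Subfield.closure (insert x (F : Set ℝ))) y) {P : F[X][X]} (hP : P ≠ 0) :
    evalAt F x y P ≠ 0 := by
  set K := Subfield.closure (insert x (F : Set ℝ))
  have hFK : F ≤ K := fun a ha => Subfield.subset_closure (Set.mem_insert_of_mem _ ha)
  have hxK : x ∈ K := Subfield.subset_closure (Set.mem_insert _ _)
  let φ : F[X] →+* K := eval₂RingHom (Subfield.inclusion hFK) ⟨x, hxK⟩
  have hφ : (algebraMap K ℝ).comp φ = (aeval x : F[X] →ₐ[F] ℝ).toRingHom := by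
    ext <;> simp [φ] <;> rfl
  have hinj : Function.Injective φ := by
    intro p q hpq
    apply transcendental_iff_injective.1 hx
    have := congrArg (algebraMap K ℝ) hpq
    rwa [← RingHom.comp_apply, ← RingHom.comp_apply, hφ] at this
  have hev : evalAt F x y P = aeval y (P.map φ) := by
    simp only [evalAt, coe_eval₂RingHom, aeval_def, eval₂_map, hφ]
  rw [hev]
  intro h0
  exact hP ((Polynomial.map_eq_zero_iff hinj).1 (transcendental_iff.1 hy _ h0))

/-- On a curve `Y = n X ^ k` of high degree only the zero polynomial vanishes identically. -/
theorem eq_zero_of_eval_eq_zero {R : Type*} [CommRing R] [IsDomain R] {a : R} (ha : a ≠ 0) {k : ℕ}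
    (P : R[X][X]) (hk : ∀ i, (P.coeff i).natDegree < k) (h : P.eval (C a * X ^ k) = 0) :
    P = 0 := by
  by_contra hP
  -- This is the exponent at which the leading monomial of the top coefficient lands. The terms with
  -- `i < P.natDegree` have degree below `k + k * i ≤ k * P.natDegree`, so nothing cancels it.
  suffices hc : (P.eval (C a * X ^ k)).coeff (k * P.natDegree + P.leadingCoeff.natDegree) ≠ 0 by
    exact hc (by rw [h, coeff_zero])
  rw [eval_eq_sum_range, finsetSum_coeff, Finset.sum_range_succ, Finset.sum_eq_zero, zero_add]
  · rw [mul_pow, ← C_pow, ← pow_mul, ← mul_assoc, add_comm, coeff_mul_X_pow, coeff_mul_C]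
    exact mul_ne_zero (leadingCoeff_ne_zero.2 (leadingCoeff_ne_zero.2 hP)) (pow_ne_zero _ ha)
  · intro i hi
    rw [Finset.mem_range] at hi
    rw [mul_pow, ← C_pow, ← pow_mul]
    apply coeff_eq_zero_of_natDegree_lt
    refine lt_of_le_of_lt (natDegree_mul_le.trans (add_le_add_right (natDegree_C_mul_X_pow_le _ _) _)) ?_
    have h1 := hk i
    have h2 : k * (i + 1) ≤ k * P.natDegree := Nat.mul_le_mul_left k hi
    rw [mul_add, mul_one] at h2
    omega

theorem exists_bound_natDegree_coeff {R : Type*} [Semiring R] (P : R[X][X]) :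
    ∃ N, ∀ i, (P.coeff i).natDegree ≤ N := by
  refine ⟨P.support.sup fun i => (P.coeff i).natDegree, fun i => ?_⟩
  by_cases hi : i ∈ P.support
  · exact Finset.le_sup (f := fun i => (P.coeff i).natDegree) hi
  · simp [notMem_support_iff.1 hi]

/-- The bound `N` depends only on the degrees of the coefficients of `P` and `R`. Its uniformity in
`n` and `c` matters, since both may vary with `k` along the approach. -/
theorem eq_C_C_mul_of_evalAt_eq (hx : Transcendental F x) (P R : F[X][X]) :
    ∃ N, ∀ k ≥ N, ∀ n : ℕ, n ≠ 0 → ∀ c : F,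
      evalAt F x (n * x ^ k) P = c * evalAt F x (n * x ^ k) R → P = C (C c) * R := by
  obtain ⟨N₁, h₁⟩ := exists_bound_natDegree_coeff P
  obtain ⟨N₂, h₂⟩ := exists_bound_natDegree_coeff R
  refine ⟨max N₁ N₂ + 1, fun k hk n hn c h => sub_eq_zero.1 ?_⟩
  have hy : (n * x ^ k : ℝ) = aeval x (C (n : F) * X ^ k : F[X]) := by simp
  have h0 : evalAt F x (n * x ^ k) (P - C (C c) * R) = 0 := by
    rw [map_sub, map_mul, evalAt_C_C, h, sub_self]
  rw [hy, evalAt_aeval] at h0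
  refine eq_zero_of_eval_eq_zero (Nat.cast_ne_zero.2 hn) _ (fun i => ?_)
    (transcendental_iff.1 hx _ h0)
  rw [coeff_sub, coeff_C_mul]
  refine (natDegree_sub_le _ _).trans_lt ?_
  have h3 := (natDegree_C_mul_le c (R.coeff i)).trans (h₂ i)
  have h4 := h₁ i
  omega

/-! ### Generic approaches and eventually rational functions. -/

/-- A point `(x, y)` with algebraically independent coordinates over `F`, approached along the
line through it by the points `(x, n k * x ^ k)`. -/
structure GenericApproach (F : Subfield ℝ) (x y : ℝ) (n : ℕ → ℕ) : Prop where
  transcendental_left : Transcendental F x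
  transcendental_right : Transcendental (Subfield.closure (insert x (F : Set ℝ))) y
  eventually_ne_zero : ∀ᶠ k in atTop, n k ≠ 0
  tendsto : Tendsto (fun k => (n k : ℝ) * x ^ k) atTop (𝓝 y)

/-- With `n k = ⌊y / x ^ k⌋₊` the error is at most `x ^ k`, which tends to `0` because `x < 1`. -/
theorem exists_genericApproach (hF : Cardinal.mk F < Cardinal.continuum) :
    ∃ x y : ℝ, ∃ n : ℕ → ℕ, 0 < x ∧ 0 < y ∧ GenericApproach F x y n := by
  obtain ⟨x, ⟨hx0, hx1⟩, hx⟩ := exists_transcendental_mem_Ioo F hF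
  have hK : Cardinal.mk (insert x (F : Set ℝ) : Set ℝ) < Cardinal.continuum :=
    Cardinal.mk_insert_le.trans_lt (Cardinal.add_lt_of_lt Cardinal.aleph0_le_continuum hF
      (Cardinal.one_lt_aleph0.trans Cardinal.aleph0_lt_continuum))
  obtain ⟨y, ⟨hy0, _⟩, hy⟩ := exists_transcendental_mem_Ioo _ (mk_subfieldClosure_lt hK)
  have ht : Tendsto (fun k => (⌊y / x ^ k⌋₊ : ℝ) * x ^ k) atTop (𝓝 y) := by
    have hlow : Tendsto (fun k => y - x ^ k) atTop (𝓝 y) := by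
      simpa using tendsto_const_nhds.sub (tendsto_pow_atTop_nhds_zero_of_lt_one hx0.le hx1)
    refine tendsto_of_tendsto_of_tendsto_of_le_of_le hlow tendsto_const_nhds (fun k => ?_)
      fun k => ?_
    · have h := Nat.lt_floor_add_one (y / x ^ k)
      rw [div_lt_iff₀ (pow_pos hx0 k)] at h
      simp only
      linarith
    · have h := Nat.floor_le (div_nonneg hy0.le (pow_pos hx0 k).le)
      rwa [le_div_iff₀ (pow_pos hx0 k)] at h
  refine ⟨x, y, fun k => ⌊y / x ^ k⌋₊, hx0, hy0, hx, hy, ?_, ht⟩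
  filter_upwards [ht.eventually_ne hy0.ne'] with k hk h0
  simp [h0] at hk

/-- The filter of the approach, including the limit point. -/
def approachFilter (x y : ℝ) (n : ℕ → ℕ) : Filter ℝ :=
  pure y ⊔ map (fun k => (n k : ℝ) * x ^ k) atTop

theorem eventually_approachFilter {n : ℕ → ℕ} {p : ℝ → Prop} :
    (∀ᶠ z in approachFilter x y n, p z) ↔ p y ∧ ∀ᶠ k in atTop, p (n k * x ^ k) := by
  simp [approachFilter, eventually_sup]

/-- The functions that agree near the limit point, along the approach, with a rational function
over `F` of both coordinates. -/
def EventuallyRational (F : Subfield ℝ) (x y : ℝ) (n : ℕ → ℕ) (f : ℝ → ℝ) : Prop :=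
  ∃ P R : F[X][X], R ≠ 0 ∧
    ∀ᶠ z in approachFilter x y n, f z = evalAt F x z P / evalAt F x z R

namespace GenericApproach

variable {n : ℕ → ℕ} {f g : ℝ → ℝ}

theorem eventually_evalAt_ne_zero (h : GenericApproach F x y n) {P : F[X][X]} (hP : P ≠ 0) :
    ∀ᶠ z in approachFilter x y n, evalAt F x z P ≠ 0 := by
  have h0 := evalAt_ne_zero h.transcendental_left h.transcendental_right hP
  exact eventually_approachFilter.2
    ⟨h0, (((continuous_evalAt P).tendsto y).comp h.tendsto).eventually_ne h0⟩

theorem eventuallyRational_const {c : ℝ} (hc : c ∈ F) :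
    EventuallyRational F x y n fun _ => c :=
  ⟨C (C ⟨c, hc⟩), 1, one_ne_zero, by simp [evalAt_C_C]⟩

theorem eventuallyRational_left : EventuallyRational F x y n fun _ => x :=
  ⟨C X, 1, one_ne_zero, by simp [evalAt_C_X]⟩

theorem eventuallyRational_id : EventuallyRational F x y n fun z => z :=
  ⟨X, 1, one_ne_zero, by simp [evalAt_X]⟩

theorem add (h : GenericApproach F x y n) (hf : EventuallyRational F x y n f)
    (hg : EventuallyRational F x y n g) : EventuallyRational F x y n fun z => f z + g z := by
  obtain ⟨P, R, hR, hf⟩ := hf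
  obtain ⟨Q, S, hS, hg⟩ := hg
  refine ⟨P * S + R * Q, R * S, mul_ne_zero hR hS, ?_⟩
  filter_upwards [hf, hg, h.eventually_evalAt_ne_zero hR, h.eventually_evalAt_ne_zero hS]
    with z h1 h2 h3 h4
  rw [h1, h2, div_add_div _ _ h3 h4]
  simp

theorem sub (h : GenericApproach F x y n) (hf : EventuallyRational F x y n f)
    (hg : EventuallyRational F x y n g) : EventuallyRational F x y n fun z => f z - g z := by
  obtain ⟨P, R, hR, hf⟩ := hf
  obtain ⟨Q, S, hS, hg⟩ := hg
  refine ⟨P * S - R * Q, R * S, mul_ne_zero hR hS, ?_⟩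
  filter_upwards [hf, hg, h.eventually_evalAt_ne_zero hR, h.eventually_evalAt_ne_zero hS]
    with z h1 h2 h3 h4
  rw [h1, h2, div_sub_div _ _ h3 h4]
  simp

theorem mul (hf : EventuallyRational F x y n f)
    (hg : EventuallyRational F x y n g) : EventuallyRational F x y n fun z => f z * g z := by
  obtain ⟨P, R, hR, hf⟩ := hf
  obtain ⟨Q, S, hS, hg⟩ := hg
  refine ⟨P * Q, R * S, mul_ne_zero hR hS, ?_⟩
  filter_upwards [hf, hg] with z h1 h2
  rw [h1, h2, div_mul_div_comm]
  simp

theorem div (hf : EventuallyRational F x y n f)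
    (hg : EventuallyRational F x y n g) (hg0 : g y ≠ 0) :
    EventuallyRational F x y n fun z => f z / g z := by
  obtain ⟨P, R, hR, hf⟩ := hf
  obtain ⟨Q, S, hS, hg⟩ := hg
  -- The filter contains the limit point, so `Q = 0` would give `g y = 0`.
  have hQ : Q ≠ 0 := by
    rintro rfl
    simp [(eventually_approachFilter.1 hg).1] at hg0
  refine ⟨P * S, R * Q, mul_ne_zero hR hQ, ?_⟩
  filter_upwards [hf, hg] with z h1 h2
  rw [h1, h2, div_div_div_eq]
  simp

theorem tendsto_of_eventuallyRational (h : GenericApproach F x y n)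
    (hf : EventuallyRational F x y n f) :
    Tendsto f (approachFilter x y n) (𝓝 (f y)) := by
  obtain ⟨P, R, hR, hf⟩ := hf
  have h0 := evalAt_ne_zero h.transcendental_left h.transcendental_right hR
  rw [(eventually_approachFilter.1 hf).1]
  refine Tendsto.congr' (hf.mono fun z hz => hz.symm) ?_
  refine (((continuous_evalAt P).tendsto y).div ((continuous_evalAt R).tendsto y) h0).mono_left ?_
  exact sup_le (pure_le_nhds y) h.tendsto

/-- A function with a value in `F` at the limit point is constant along the approach. -/
theorem eventually_eq_of_mem (h : GenericApproach F x y n) (hf : EventuallyRational F x y n f)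
    (hc : f y ∈ F) : ∀ᶠ z in approachFilter x y n, f z = f y := by
  obtain ⟨P, R, hR, hf⟩ := hf
  have h0 := evalAt_ne_zero h.transcendental_left h.transcendental_right hR
  -- At a generic point an equality of values is an identity of polynomials.
  have hP : P = C (C ⟨f y, hc⟩) * R := by
    by_contra hne
    apply evalAt_ne_zero h.transcendental_left h.transcendental_right (sub_ne_zero.2 hne)
    have := (eventually_approachFilter.1 hf).1
    rw [map_sub, map_mul, evalAt_C_C]
    simp only
    rw [this, div_mul_cancel₀ _ h0, sub_self]
  filter_upwards [hf, h.eventually_evalAt_ne_zero hR] with z h1 h2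
  rw [h1, hP, map_mul, evalAt_C_C, mul_div_cancel_right₀ _ h2]

/-- A function with a value outside `F` at the limit point avoids `F` along the approach. -/
theorem eventually_notMem (h : GenericApproach F x y n) (hf : EventuallyRational F x y n f)
    (hc : f y ∉ F) : ∀ᶠ z in approachFilter x y n, f z ∉ F := by
  obtain ⟨P, R, hR, hf⟩ := hf
  obtain ⟨N, hN⟩ := eq_C_C_mul_of_evalAt_eq h.transcendental_left P R
  have h0 := evalAt_ne_zero h.transcendental_left h.transcendental_right hR
  obtain ⟨hfy, hf'⟩ := eventually_approachFilter.1 hf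
  refine eventually_approachFilter.2 ⟨hc, ?_⟩
  filter_upwards [hf', h.eventually_ne_zero, eventually_ge_atTop N,
    (eventually_approachFilter.1 (h.eventually_evalAt_ne_zero hR)).2] with k h1 h2 h3 h4 hmem
  -- One value in `F` this far along makes `P / R` a constant of `F`, contrary to the value at `y`.
  have hP := hN k h3 (n k) h2 ⟨_, hmem⟩ (by simp only; rw [h1, div_mul_cancel₀ _ h4])
  apply hc
  rw [hfy, hP, map_mul, evalAt_C_C, mul_div_cancel_right₀ _ h0]
  exact hmem

end GenericApproach

end BSS

/-! ### Determinism of runs, and their simulation along a generic approach. -/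

namespace BSS

open Filter Topology

theorem Tape.Holds.unique {t : Tape} {v w : Tuple} (hv : t.Holds v) (hw : t.Holds w) : v = w := by
  have key : ∀ {v w : Tuple}, t.Holds v → t.Holds w → w.length ≤ v.length := by
    intro v w hv hw
    by_contra! h
    have h1 := hv v.length le_rfl
    rw [hw v.length h.le, List.getElem?_eq_getElem h, List.getElem?_eq_none le_rfl] at h1
    exact absurd h1 (by simp)
  have hl : v.length = w.length := le_antisymm (key hw hv) (key hv hw)
  refine List.ext_getElem? fun m => ?_
  rcases le_total m v.length with hm | hm
  · rw [← hv m hm, hw m (hl ▸ hm)]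
  · rw [List.getElem?_eq_none hm, List.getElem?_eq_none (hl ▸ hm)]

theorem Step.unique {C : Set Tuple} {P : Program} {a b c : Config} (hb : Step C P a b)
    (hc : Step C P a c) : b = c := by
  obtain ⟨I, hI, hb⟩ := hb
  obtain ⟨J, hJ, hc⟩ := hc
  obtain rfl : I = J := Option.some_injective _ (hI.symm.trans hJ)
  exact Option.some_injective _ (hb.symm.trans hc)

theorem not_step_of_length_le {C : Set Tuple} {P : Program} {a b : Config}
    (h : P.length ≤ a.line) : ¬ Step C P a b := by
  rintro ⟨I, hI, -⟩
  simp [List.getElem?_eq_none h] at hI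

theorem reflTransGen_of_length_le {C : Set Tuple} {P : Program} {a b c : Config}
    (hb : Relation.ReflTransGen (Step C P) a b) (hc : Relation.ReflTransGen (Step C P) a c)
    (hcl : P.length ≤ c.line) : Relation.ReflTransGen (Step C P) b c := by
  induction hb with
  | refl => exact hc
  | tail _ h ih =>
    rcases Relation.ReflTransGen.cases_head ih with rfl | ⟨d, hd, hdc⟩
    · exact absurd h (not_step_of_length_le hcl)
    · rwa [h.unique hd]

theorem HaltsIn.unique {C : Set Tuple} {P : Program} {x : Tuple} {b c : Config}
    (hb : HaltsIn C P x b) (hc : HaltsIn C P x c) : b = c := by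
  rcases Relation.ReflTransGen.cases_head (reflTransGen_of_length_le hb.1 hc.1 hc.2) with
    h | ⟨d, hd, -⟩
  · exact h
  · exact absurd hd (not_step_of_length_le hb.2)

theorem Outputs.unique {C : Set Tuple} {P : Program} {x v w : Tuple}
    (hv : Outputs C P x v) (hw : Outputs C P x w) : v = w := by
  obtain ⟨b, hb, hbv⟩ := hv
  obtain ⟨c, hc, hcw⟩ := hw
  obtain rfl := hb.unique hc
  exact hbv.unique hcw

/-- A tape whose cells hold functions of a real parameter. -/
abbrev FunTape : Type := ℤ → Option (ℝ → ℝ)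

/-- The tape at the value `z` of the parameter. -/
def FunTape.at (T : FunTape) (z : ℝ) : Tape := fun i => (T i).map fun f => f z

/-- The tape holds exactly the given tuple of functions. -/
def FunTape.ofList (fs : List (ℝ → ℝ)) : FunTape :=
  fun i => if 0 ≤ i then fs[i.toNat]? else none

theorem FunTape.at_ofList (fs : List (ℝ → ℝ)) (z : ℝ) :
    (FunTape.ofList fs).at z = Tape.ofTuple (fs.map fun f => f z) := by
  funext i
  by_cases h : 0 ≤ i <;> simp [FunTape.at, FunTape.ofList, Tape.ofTuple, h]

theorem FunTape.at_update (T : FunTape) (i : ℤ) (o : Option (ℝ → ℝ)) (z : ℝ) :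
    FunTape.at (Function.update T i o) z = Function.update (T.at z) i (o.map fun f => f z) := by
  funext j
  rcases eq_or_ne j i with rfl | h
  · simp [FunTape.at]
  · simp [FunTape.at, h]

theorem FunTape.holds_at_of_list {T : FunTape} {fs : List (ℝ → ℝ)}
    (h : ∀ m ≤ fs.length, T (m : ℕ) = fs[m]?) (z : ℝ) :
    (T.at z).Holds (fs.map fun f => f z) := by
  intro m hm
  rw [List.length_map] at hm
  simp [FunTape.at, h m hm]

/-- Which cells are blank does not depend on the parameter, so a tuple standing at the head for one
value comes from a list of functions valid for all values. -/
theorem FunTape.exists_list_of_holds {T : FunTape} {z : ℝ} {v : Tuple} (h : (T.at z).Holds v) :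
    ∃ fs : List (ℝ → ℝ), ∀ m ≤ fs.length, T (m : ℕ) = fs[m]? := by
  refine ⟨(List.range v.length).map fun m => (T (m : ℕ)).getD 0, fun m hm => ?_⟩
  have hm' : m ≤ v.length := by simpa using hm
  have h1 := h m hm'
  rcases hm'.lt_or_eq with hlt | rfl
  · rw [List.getElem?_eq_getElem hlt, FunTape.at, Option.map_eq_some_iff] at h1
    obtain ⟨f, hf, -⟩ := h1
    simp [hf, hlt]
  · rw [List.getElem?_eq_none le_rfl, FunTape.at, Option.map_eq_none_iff] at h1
    simp [h1]

/-- All cells hold eventually rational functions. -/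
def FunTape.Rational (F : Subfield ℝ) (x y : ℝ) (n : ℕ → ℕ) (T : FunTape) : Prop :=
  ∀ i f, T i = some f → EventuallyRational F x y n f

section Simulation

variable {F : Subfield ℝ} {x y : ℝ} {n : ℕ → ℕ} {T : FunTape}

theorem FunTape.Rational.update (hT : T.Rational F x y n) (i : ℤ) {o : Option (ℝ → ℝ)}
    (ho : ∀ f, o = some f → EventuallyRational F x y n f) :
    FunTape.Rational F x y n (Function.update T i o) := by
  intro j f hf
  rcases eq_or_ne j i with rfl | h
  · exact ho f (by simpa using hf)
  · exact hT j f (by simpa [h] using hf)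

/-- A zero value lies in `F` and so persists by rigidity; a nonzero value keeps its sign by
continuity. -/
theorem GenericApproach.eventually_passes_iff (h : GenericApproach F x y n)
    (hT : T.Rational F x y n) (test : CellTest) (i : ℤ) :
    ∀ᶠ z in approachFilter x y n, test.Passes (T.at z i) ↔ test.Passes (T.at y i) := by
  rcases hi : T i with _ | f
  · simp [FunTape.at, hi]
  simp only [FunTape.at, hi, Option.map_some]
  have hf := hT i f hi
  rcases eq_or_ne (f y) 0 with h0 | h0
  · filter_upwards [h.eventually_eq_of_mem hf (h0 ▸ F.zero_mem)] with z hz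
    rw [hz]
  have ht := h.tendsto_of_eventuallyRational hf
  rcases h0.lt_or_gt with hlt | hgt
  · filter_upwards [ht.eventually_lt_const hlt] with z hz
    cases test <;> simp [CellTest.Passes, hlt, hz, hlt.ne, hz.ne, hlt.not_gt, hz.not_gt]
  · filter_upwards [ht.eventually_const_lt hgt] with z hz
    cases test <;> simp [CellTest.Passes, hgt, hz, hgt.ne', hz.ne', hgt.not_gt, hz.not_gt]

theorem GenericApproach.exists_eval (h : GenericApproach F x y n) {f g : ℝ → ℝ}
    (hf : EventuallyRational F x y n f) (hg : EventuallyRational F x y n g) (op : FieldOp)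
    {r : ℝ} (hr : op.eval (f y) (g y) = some r) :
    ∃ e, EventuallyRational F x y n e ∧
      ∀ᶠ z in approachFilter x y n, op.eval (f z) (g z) = some (e z) := by
  cases op with
  | add => exact ⟨_, h.add hf hg, Eventually.of_forall fun z => rfl⟩
  | sub => exact ⟨_, h.sub hf hg, Eventually.of_forall fun z => rfl⟩
  | mul => exact ⟨_, mul hf hg, Eventually.of_forall fun z => rfl⟩
  | div =>
    have hg0 : g y ≠ 0 := by
      intro h0
      simp [FieldOp.eval, h0] at hr
    refine ⟨_, div hf hg hg0, ?_⟩
    filter_upwards [(h.tendsto_of_eventuallyRational hg).eventually_ne hg0] with z hz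
    simp [FieldOp.eval, hz]

variable {C D : Set Tuple}

theorem GenericApproach.eventually_query_iff (h : GenericApproach F x y n)
    (hT : T.Rational F x y n) (hD : ∀ v ∈ D, ∀ r ∈ v, r ∈ F)
    (hCD : ∀ v w : Tuple, v.length = w.length → (v ∈ D ↔ w ∈ D) → (v ∈ C ↔ w ∈ C)) :
    ∀ᶠ z in approachFilter x y n,
      (∃ v ∈ C, (T.at z).Holds v) ↔ ∃ v ∈ C, (T.at y).Holds v := by
  by_cases hfs : ∃ fs : List (ℝ → ℝ), ∀ m ≤ fs.length, T (m : ℕ) = fs[m]?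
  swap
  · refine Eventually.of_forall fun z => iff_of_false ?_ ?_ <;>
    · rintro ⟨v, -, hv⟩
      exact hfs (FunTape.exists_list_of_holds hv)
  obtain ⟨fs, hfs⟩ := hfs
  have key : ∀ z, (∃ v ∈ C, (T.at z).Holds v) ↔ fs.map (fun f => f z) ∈ C := by
    intro z
    have hz := FunTape.holds_at_of_list hfs z
    refine ⟨?_, fun hC => ⟨_, hC, hz⟩⟩
    rintro ⟨v, hv, hvz⟩
    rwa [hz.unique hvz]
  simp only [key]
  have hrat : ∀ f ∈ fs, EventuallyRational F x y n f := by
    intro f hf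
    obtain ⟨m, hm, rfl⟩ := List.getElem_of_mem hf
    exact hT m _ ((hfs m hm.le).trans (List.getElem?_eq_getElem hm))
  suffices hmem : ∀ᶠ z in approachFilter x y n,
      fs.map (fun f => f z) ∈ D ↔ fs.map (fun f => f y) ∈ D from
    hmem.mono fun z hz => hCD _ _ (by simp) hz
  -- Either the queried tuple is constant along the approach, or one entry stays outside `F` and the
  -- tuple is never in `D`.
  by_cases hF : ∀ f ∈ fs, f y ∈ F
  · have hall : ∀ᶠ z in approachFilter x y n, ∀ f ∈ {f | f ∈ fs}, f z = f y :=
      (eventually_all_finite fs.finite_toSet).2 fun f hf =>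
        h.eventually_eq_of_mem (hrat f hf) (hF f hf)
    filter_upwards [hall] with z hz
    rw [List.map_congr_left hz]
  · push Not at hF
    obtain ⟨f, hf, hfF⟩ := hF
    filter_upwards [h.eventually_notMem (hrat f hf) hfF] with z hz
    exact iff_of_false (fun hm => hz (hD _ hm _ (List.mem_map_of_mem hf)))
      (fun hm => hfF (hD _ hm _ (List.mem_map_of_mem hf)))

/-- A step of the run at the limit point is the same step along the approach. -/
theorem GenericApproach.exists_step (h : GenericApproach F x y n)
    (hT : T.Rational F x y n) (hD : ∀ v ∈ D, ∀ r ∈ v, r ∈ F)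
    (hCD : ∀ v w : Tuple, v.length = w.length → (v ∈ D ↔ w ∈ D) → (v ∈ C ↔ w ∈ C))
    {P : Program} (hP : ∀ i r, Instr.const i r ∈ P → r ∈ F) {l : ℕ} {c : Config}
    (hc : Step C P ⟨l, T.at y⟩ c) :
    ∃ S : FunTape, S.Rational F x y n ∧
      ∀ᶠ z in approachFilter x y n, Step C P ⟨l, T.at z⟩ ⟨c.line, S.at z⟩ := by
  obtain ⟨I, hI, hc⟩ := hc
  suffices hs : ∃ S : FunTape, S.Rational F x y n ∧
      ∀ᶠ z in approachFilter x y n, I.exec C ⟨l, T.at z⟩ = some ⟨c.line, S.at z⟩ by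
    obtain ⟨S, hS, hs⟩ := hs
    exact ⟨S, hS, hs.mono fun z hz => ⟨I, hI, hz⟩⟩
  cases I with
  | const i r =>
    obtain rfl := Option.some_injective _ hc
    refine ⟨Function.update T i (some fun _ => r), hT.update i ?_, Eventually.of_forall fun z => ?_⟩
    · rintro f ⟨⟩
      exact eventuallyRational_const (hP i r (List.mem_of_getElem? hI))
    · simp [Instr.exec, FunTape.at_update]
  | copy i j =>
    obtain rfl := Option.some_injective _ hc
    refine ⟨Function.update T i (T j), hT.update i (hT j), Eventually.of_forall fun z => ?_⟩
    simp [Instr.exec, FunTape.at_update]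
    rfl
  | delete i =>
    obtain rfl := Option.some_injective _ hc
    refine ⟨Function.update T i none, hT.update i (by simp), Eventually.of_forall fun z => ?_⟩
    simp [Instr.exec, FunTape.at_update]
  | arith op i j k =>
    rcases hj : T j with _ | f
    · simp [Instr.exec, FunTape.at, hj] at hc
    rcases hk : T k with _ | g
    · simp [Instr.exec, FunTape.at, hj, hk] at hc
    simp only [Instr.exec, FunTape.at, hj, hk, Option.map_some, Option.map_eq_some_iff] at hc
    obtain ⟨r, hr, rfl⟩ := hc
    obtain ⟨e, he, hev⟩ := h.exists_eval (hT j f hj) (hT k g hk) op hr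
    refine ⟨Function.update T i (some e), hT.update i (by rintro _ ⟨⟩; exact he), ?_⟩
    filter_upwards [hev] with z hz
    rw [FunTape.at_update]
    simp [Instr.exec, FunTape.at, hj, hk, hz]
  | shift d =>
    obtain rfl := Option.some_injective _ hc
    exact ⟨fun i => T (i + d), fun i f hf => hT _ f hf, Eventually.of_forall fun z => rfl⟩
  | fork test i q =>
    obtain rfl := Option.some_injective _ hc
    refine ⟨T, hT, ?_⟩
    filter_upwards [h.eventually_passes_iff hT test i] with z hz
    classical exact congrArg some (congrArg (Config.mk · _) (if_congr hz rfl rfl))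
  | jump q =>
    obtain rfl := Option.some_injective _ hc
    exact ⟨T, hT, Eventually.of_forall fun z => rfl⟩
  | query q =>
    obtain rfl := Option.some_injective _ hc
    refine ⟨T, hT, ?_⟩
    filter_upwards [h.eventually_query_iff hT hD hCD] with z hz
    classical exact congrArg some (congrArg (Config.mk · _) (if_congr hz rfl rfl))

theorem GenericApproach.exists_reflTransGen (h : GenericApproach F x y n)
    (hD : ∀ v ∈ D, ∀ r ∈ v, r ∈ F)
    (hCD : ∀ v w : Tuple, v.length = w.length → (v ∈ D ↔ w ∈ D) → (v ∈ C ↔ w ∈ C))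
    {P : Program} (hP : ∀ i r, Instr.const i r ∈ P → r ∈ F)
    {fs : List (ℝ → ℝ)} (hfs : ∀ f ∈ fs, EventuallyRational F x y n f) {c : Config}
    (hc : Relation.ReflTransGen (Step C P) (Config.start (fs.map fun f => f y)) c) :
    ∃ T : FunTape, T.Rational F x y n ∧ c.tape = T.at y ∧
      ∀ᶠ z in approachFilter x y n,
        Relation.ReflTransGen (Step C P) (Config.start (fs.map fun f => f z)) ⟨c.line, T.at z⟩ := by
  induction hc with
  | refl =>
    refine ⟨FunTape.ofList fs, fun i f hf => ?_, (FunTape.at_ofList _ _).symm,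
      Eventually.of_forall fun z => ?_⟩
    · by_cases hi : 0 ≤ i
      · rw [FunTape.ofList, if_pos hi] at hf
        exact hfs f (List.mem_of_getElem? hf)
      · simp [FunTape.ofList, hi] at hf
    · rw [FunTape.at_ofList]
      exact .refl
  | @tail b c _ hbc ih =>
    obtain ⟨T, hT, hbT, ih⟩ := ih
    obtain ⟨l, t⟩ := b
    obtain rfl : t = T.at y := hbT
    obtain ⟨S, hS, hst⟩ := h.exists_step hT hD hCD hP hbc
    refine ⟨S, hS, ?_, ?_⟩
    · exact congrArg Config.tape (hbc.unique (eventually_approachFilter.1 hst).1)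
    · filter_upwards [ih, hst] with z h1 h2
      exact h1.tail h2

/-- The output cell has its value `r` in `F` at the limit point, hence holds exactly `r` along the
approach, not merely something close to it. -/
theorem GenericApproach.eventually_outputs (h : GenericApproach F x y n)
    (hD : ∀ v ∈ D, ∀ r ∈ v, r ∈ F)
    (hCD : ∀ v w : Tuple, v.length = w.length → (v ∈ D ↔ w ∈ D) → (v ∈ C ↔ w ∈ C))
    {P : Program} (hP : ∀ i r, Instr.const i r ∈ P → r ∈ F)
    {fs : List (ℝ → ℝ)} (hfs : ∀ f ∈ fs, EventuallyRational F x y n f) {r : ℝ} (hr : r ∈ F)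
    (ho : Outputs C P (fs.map fun f => f y) [r]) :
    ∀ᶠ z in approachFilter x y n, Outputs C P (fs.map fun f => f z) [r] := by
  obtain ⟨c, ⟨hc, hl⟩, hold⟩ := ho
  obtain ⟨T, hT, hcT, hev⟩ := h.exists_reflTransGen hD hCD hP hfs hc
  rw [hcT] at hold
  obtain ⟨gs, hgs⟩ := FunTape.exists_list_of_holds hold
  have hmap := (FunTape.holds_at_of_list hgs y).unique hold
  obtain ⟨g, rfl, hg⟩ : ∃ g, gs = [g] ∧ g y = r := by
    rwa [List.map_eq_singleton_iff] at hmap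
  have hgr := hT 0 g (by simpa using hgs 0 (by simp))
  filter_upwards [hev, h.eventually_eq_of_mem hgr (hg ▸ hr)] with z hz hgz
  refine ⟨_, ⟨hz, hl⟩, ?_⟩
  have := FunTape.holds_at_of_list hgs z
  rwa [List.map_singleton, hgz, hg] at this

end Simulation

end BSS

/-! ### The search program and the inputs on which it halts. -/

namespace BSS

open Filter Topology

/-- On input `(x, y)` this program searches for natural numbers `n`, `k` with `y = n * x ^ k`:
cell `2` runs through the powers of `x`, and multiples of it are subtracted from `y` in
cell `3`. -/
noncomputable def searchProgram : Program :=
  [.const 2 1, .copy 3 1, .fork .eqZero 3 8, .fork .ltZero 3 6, .arith .sub 3 3 2, .jump 2,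
    .arith .mul 2 2 0, .jump 1]

theorem searchProgram_isOracleFree : searchProgram.IsOracleFree := by
  intro q
  simp [searchProgram]

section Search

variable {x y w r : ℝ} {t : Tape}

/-- The cells `0`, `1`, `2` hold `x`, `y`, `w`. -/
def Tape.SearchState (x y w : ℝ) (t : Tape) : Prop :=
  t 0 = some x ∧ t 1 = some y ∧ t 2 = some w

local notation "Reaches" => Relation.ReflTransGen (Step ∅ searchProgram)

theorem step_searchProgram {I : Instr} {l : ℕ} {c : Config} (hI : searchProgram[l]? = some I)
    (hc : I.exec ∅ ⟨l, t⟩ = some c) : Step ∅ searchProgram ⟨l, t⟩ c :=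
  ⟨I, hI, hc⟩

theorem reaches_of_neg (ht : t.SearchState x y w) (h3 : t 3 = some r) (hr : r < 0) :
    ∃ t' : Tape, t'.SearchState x y (w * x) ∧ Reaches ⟨2, t⟩ ⟨1, t'⟩ := by
  obtain ⟨h0, h1, h2⟩ := ht
  refine ⟨Function.update t 2 (some (w * x)), ⟨by simp [h0], by simp [h1], by simp⟩, ?_⟩
  refine .head (b := ⟨3, t⟩) (step_searchProgram rfl ?_) <|
    .head (b := ⟨6, t⟩) (step_searchProgram rfl ?_) <|
    .head (b := ⟨7, Function.update t 2 (some (w * x))⟩) (step_searchProgram rfl ?_) <|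
    .single (step_searchProgram rfl ?_)
  · simp [Instr.exec, CellTest.Passes, h3, hr.ne]
  · simp [Instr.exec, CellTest.Passes, h3, hr]
  · simp [Instr.exec, FieldOp.eval, h0, h2]
  · simp [Instr.exec]

theorem reaches_of_pos (ht : t.SearchState x y w) (h3 : t 3 = some r) (hr : 0 < r) :
    ∃ t' : Tape, t'.SearchState x y w ∧ t' 3 = some (r - w) ∧ Reaches ⟨2, t⟩ ⟨2, t'⟩ := by
  obtain ⟨h0, h1, h2⟩ := ht
  refine ⟨Function.update t 3 (some (r - w)), ⟨by simp [h0], by simp [h1], by simp [h2]⟩,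
    by simp, ?_⟩
  refine .head (b := ⟨3, t⟩) (step_searchProgram rfl ?_) <|
    .head (b := ⟨4, t⟩) (step_searchProgram rfl ?_) <|
    .head (b := ⟨5, Function.update t 3 (some (r - w))⟩) (step_searchProgram rfl ?_) <|
    .single (step_searchProgram rfl ?_)
  · simp [Instr.exec, CellTest.Passes, h3, hr.ne']
  · simp [Instr.exec, CellTest.Passes, h3, hr.le]
  · simp [Instr.exec, FieldOp.eval, h3, h2]
  · simp [Instr.exec]

theorem reaches_of_eq_zero (h3 : t 3 = some 0) : Reaches ⟨2, t⟩ ⟨8, t⟩ :=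
  .single (step_searchProgram rfl (by simp [Instr.exec, CellTest.Passes, h3]))

/-- The inner loop ends: either it meets `0`, or the next power of `x` is taken. -/
theorem reaches_innerLoop (m : ℕ) :
    ∀ {r : ℝ} {t : Tape}, r < m * w → t.SearchState x y w → t 3 = some r →
      (∃ t', Reaches ⟨2, t⟩ ⟨8, t'⟩) ∨
        ∃ t' : Tape, t'.SearchState x y (w * x) ∧ Reaches ⟨2, t⟩ ⟨1, t'⟩ := by
  induction m with
  | zero =>
    intro r t hr ht h3
    exact .inr (reaches_of_neg ht h3 (by simpa using hr))
  | succ m ih =>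
    intro r t hr ht h3
    rcases lt_trichotomy r 0 with h | rfl | h
    · exact .inr (reaches_of_neg ht h3 h)
    · exact .inl ⟨t, reaches_of_eq_zero h3⟩
    · obtain ⟨t₁, ht₁, h3₁, hs⟩ := reaches_of_pos ht h3 h
      push_cast at hr
      rcases ih (by linarith) ht₁ h3₁ with ⟨t', h'⟩ | ⟨t', ht', h'⟩
      · exact .inl ⟨t', hs.trans h'⟩
      · exact .inr ⟨t', ht', hs.trans h'⟩

theorem reaches_innerLoop_of_eq (hw : 0 < w) (n : ℕ) :
    ∀ {t : Tape}, t.SearchState x y w → t 3 = some (n * w) → ∃ t', Reaches ⟨2, t⟩ ⟨8, t'⟩ := by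
  induction n with
  | zero =>
    intro t ht h3
    exact ⟨t, reaches_of_eq_zero (by simpa using h3)⟩
  | succ n ih =>
    intro t ht h3
    obtain ⟨t₁, ht₁, h3₁, hs⟩ := reaches_of_pos ht h3 (by positivity)
    obtain ⟨t', h'⟩ := ih ht₁ (by rw [h3₁]; push_cast; ring_nf)
    exact ⟨t', hs.trans h'⟩

theorem exists_reaches_copy (ht : t.SearchState x y w) :
    ∃ t' : Tape, t'.SearchState x y w ∧ t' 3 = some y ∧ Reaches ⟨1, t⟩ ⟨2, t'⟩ := by
  obtain ⟨h0, h1, h2⟩ := ht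
  exact ⟨Function.update t 3 (some y), ⟨by simp [h0], by simp [h1], by simp [h2]⟩, by simp,
    .single (step_searchProgram rfl (by simp [Instr.exec, h1]))⟩

/-- The induction is on the number of powers of `x` still to be passed. At each one the inner loop
either meets `0`, perhaps through an earlier representation of `y`, or becomes negative and replaces
`w` by `w * x`. -/
theorem reaches_outerLoop (hx : 0 < x) {n : ℕ} (k : ℕ) :
    ∀ {w : ℝ} {t : Tape}, 0 < w → y = n * (w * x ^ k) → t.SearchState x y w →
      ∃ t', Reaches ⟨1, t⟩ ⟨8, t'⟩ := by
  induction k with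
  | zero =>
    intro w t hw hy ht
    obtain ⟨t₁, ht₁, h3, hs⟩ := exists_reaches_copy ht
    obtain ⟨t', h'⟩ := reaches_innerLoop_of_eq hw n ht₁ (by rw [h3, hy, pow_zero, mul_one])
    exact ⟨t', hs.trans h'⟩
  | succ k ih =>
    intro w t hw hy ht
    obtain ⟨t₁, ht₁, h3, hs⟩ := exists_reaches_copy ht
    obtain ⟨m, hm⟩ := exists_nat_gt (y / w)
    rcases reaches_innerLoop m ((div_lt_iff₀ hw).1 hm) ht₁ h3 with ⟨t', h'⟩ | ⟨t₂, ht₂, h₂⟩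
    · exact ⟨t', hs.trans h'⟩
    · obtain ⟨t', h'⟩ := ih (mul_pos hw hx) (by rw [hy]; ring) ht₂
      exact ⟨t', hs.trans (h₂.trans h')⟩

theorem halts_searchProgram (hx : 0 < x) (n k : ℕ) : Halts searchProgram [x, n * x ^ k] := by
  have h0 : Tape.SearchState x (n * x ^ k) 1
      (Function.update (Tape.ofTuple [x, n * x ^ k]) 2 (some 1)) := by
    refine ⟨?_, ?_, ?_⟩ <;> simp [Tape.ofTuple]
  obtain ⟨t', h'⟩ := reaches_outerLoop hx k one_pos (by rw [one_mul]) h0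
  exact ⟨⟨8, t'⟩, .head (step_searchProgram rfl rfl) h', le_rfl⟩

/-- What holds throughout a run of `searchProgram`. -/
def SearchInvariant (x y : ℝ) (c : Config) : Prop :=
  c.tape 0 = some x ∧ c.tape 1 = some y ∧ (c.line = 0 ∨
    -- Nothing is claimed of cell `3` just before it is reset or just after the power has changed.
    -- The halting line can be entered only through the zero test, whence the final alternative.
    ∃ k : ℕ, c.tape 2 = some (x ^ k) ∧ (c.line = 1 ∨ c.line = 7 ∨
      ∃ n : ℕ, c.tape 3 = some (y - n * x ^ k) ∧ (c.line < 8 ∨ y = n * x ^ k)))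

theorem SearchInvariant.step {c d : Config} (hc : SearchInvariant x y c)
    (hs : Step ∅ searchProgram c d) : SearchInvariant x y d := by
  obtain ⟨l, t⟩ := c
  obtain ⟨h0, h1, hc⟩ := hc
  obtain ⟨I, hI, hd⟩ := hs
  have hl : l < 8 := by
    by_contra! hl
    rw [List.getElem?_eq_none (by simpa [searchProgram] using hl)] at hI
    exact absurd hI (by simp)
  simp only at h0 h1 hc hI
  interval_cases l
  all_goals
    obtain rfl := Option.some_injective _ hI
    simp at hc
  · obtain rfl := Option.some_injective _ hd
    exact ⟨by simp [h0], by simp [h1], .inr ⟨0, by simp, .inl rfl⟩⟩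
  · obtain ⟨k, h2⟩ := hc
    obtain rfl := Option.some_injective _ hd
    exact ⟨by simp [h0], by simp [h1], .inr ⟨k, by simp [h2], .inr (.inr ⟨0, by simp [h1], .inl (by simp)⟩)⟩⟩
  · obtain ⟨k, h2, n, h3⟩ := hc
    obtain rfl := Option.some_injective _ hd
    refine ⟨h0, h1, .inr ⟨k, h2, .inr (.inr ⟨n, h3, ?_⟩)⟩⟩
    by_cases h : CellTest.eqZero.Passes (t 3)
    · right
      rw [h3] at h
      exact sub_eq_zero.1 h
    · simp [h]
  · obtain ⟨k, h2, n, h3⟩ := hc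
    obtain rfl := Option.some_injective _ hd
    refine ⟨h0, h1, .inr ⟨k, h2, .inr (.inr ⟨n, h3, .inl ?_⟩)⟩⟩
    dsimp only
    split_ifs <;> simp
  · obtain ⟨k, h2, n, h3⟩ := hc
    simp only [Instr.exec, h2, h3, FieldOp.eval, Option.map_some, Option.some.injEq] at hd
    subst hd
    refine ⟨by simp [h0], by simp [h1], .inr ⟨k, by simp [h2], .inr (.inr ⟨n + 1, ?_, .inl (by simp)⟩)⟩⟩
    simp
    ring
  · obtain rfl := Option.some_injective _ hd
    obtain ⟨k, h2, n, h3⟩ := hc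
    exact ⟨h0, h1, .inr ⟨k, h2, .inr (.inr ⟨n, h3, .inl (by simp)⟩)⟩⟩
  · obtain ⟨k, h2, n, h3⟩ := hc
    simp only [Instr.exec, h2, h0, FieldOp.eval, Option.map_some, Option.some.injEq] at hd
    subst hd
    exact ⟨by simp [h0], by simp [h1], .inr ⟨k + 1, by simp [pow_succ], .inr (.inl rfl)⟩⟩
  · obtain rfl := Option.some_injective _ hd
    obtain ⟨k, h2⟩ := hc
    exact ⟨h0, h1, .inr ⟨k, h2, .inl rfl⟩⟩

theorem exists_eq_of_halts_searchProgram (h : Halts searchProgram [x, y]) :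
    ∃ n k : ℕ, y = n * x ^ k := by
  obtain ⟨c, hc, hl⟩ := h
  have hinv : SearchInvariant x y c := by
    clear hl
    induction hc with
    | refl => exact ⟨by simp [Config.start, Tape.ofTuple], by simp [Config.start, Tape.ofTuple],
        .inl rfl⟩
    | tail _ hs ih => exact ih.step hs
  have hl8 : 8 ≤ c.line := hl
  obtain ⟨-, -, h | ⟨k, -, h | h | ⟨n, -, h | h⟩⟩⟩ := hinv
  · omega
  · omega
  · omega
  · omega
  · exact ⟨n, k, h⟩

end Search

/-! ### The contradiction for a small oracle, and the cardinalities. -/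

theorem codePair_mem_haltingProblem_iff {P : Program} (hP : P.IsOracleFree) {x : Tuple} :
    codePair P x ∈ haltingProblem ↔ Halts P x := by
  constructor
  · rintro ⟨Q, z, -, hQ, h⟩
    obtain ⟨rfl, rfl⟩ := codePair_injective h
    exact hQ
  · exact fun h => ⟨P, x, hP, h, rfl⟩

theorem GenericApproach.not_halts_searchProgram {F : Subfield ℝ} {x y : ℝ} {n : ℕ → ℕ}
    (h : GenericApproach F x y n) : ¬ Halts searchProgram [x, y] := by
  intro hh
  obtain ⟨m, k, hm⟩ := exists_eq_of_halts_searchProgram hh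
  refine h.transcendental_right ?_
  have hx : x ∈ Subfield.closure (insert x (F : Set ℝ)) :=
    Subfield.subset_closure (Set.mem_insert _ _)
  rw [hm]
  exact isAlgebraic_algebraMap (A := ℝ)
    (⟨m * x ^ k, mul_mem (natCast_mem _ m) (pow_mem hx k)⟩ :
      Subfield.closure (insert x (F : Set ℝ)))

/-- An entry is determined by a tuple of `D` and an index, and `D × ℕ` is still smaller than the
continuum. -/
theorem mk_entries_lt {D : Set Tuple} (hD : Cardinal.mk D < Cardinal.continuum) :
    Cardinal.mk {r : ℝ | ∃ v ∈ D, r ∈ v} < Cardinal.continuum := by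
  have hsub : {r : ℝ | ∃ v ∈ D, r ∈ v} ⊆
      Set.range fun p : D × ℕ => (p.1 : Tuple).getD p.2 0 := by
    rintro r ⟨v, hv, hr⟩
    obtain ⟨m, hm, rfl⟩ := List.getElem_of_mem hr
    exact ⟨(⟨v, hv⟩, m), by simp [hm]⟩
  refine ((Cardinal.mk_le_mk_of_subset hsub).trans Cardinal.mk_range_le).trans_lt ?_
  rw [Cardinal.mk_prod, Cardinal.lift_id, Cardinal.lift_id, Cardinal.mk_nat]
  exact Cardinal.mul_lt_of_lt Cardinal.aleph0_le_continuum hD Cardinal.aleph0_lt_continuum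

/-- If membership in `C` depends only on the length of a tuple and on membership in a set with
fewer than continuum many elements, then the halting problem is not reducible to `C`. -/
theorem not_reducible_haltingProblem {C D : Set Tuple} (hD : Cardinal.mk D < Cardinal.continuum)
    (hCD : ∀ v w : Tuple, v.length = w.length → (v ∈ D ↔ w ∈ D) → (v ∈ C ↔ w ∈ C)) :
    ¬ Reducible haltingProblem C := by
  rintro ⟨P, hP⟩
  set A : Set ℝ := {r | ∃ i, Instr.const i r ∈ P} with hA
  have hAc : A.Countable := by
    have : A ⊆ ⋃ I ∈ {I | I ∈ P}, {r | ∃ i, I = Instr.const i r} := by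
      rintro r ⟨i, hi⟩
      exact Set.mem_biUnion (show Instr.const i r ∈ {I | I ∈ P} from hi) ⟨i, rfl⟩
    refine (P.finite_toSet.countable.biUnion fun I _ => ?_).mono this
    refine Set.Subsingleton.countable ?_
    rintro r ⟨i, rfl⟩ s ⟨j, hj⟩
    exact (Instr.const.inj hj).2
  set B : Set ℝ := {r | r ∈ Program.code searchProgram} with hB
  have hBc : B.Countable := (List.finite_toSet _).countable
  set F := Subfield.closure ({r : ℝ | ∃ v ∈ D, r ∈ v} ∪ (A ∪ B)) with hF
  have hFc : Cardinal.mk F < Cardinal.continuum := by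
    refine mk_subfieldClosure_lt ((Cardinal.mk_union_le _ _).trans_lt ?_)
    exact Cardinal.add_lt_of_lt Cardinal.aleph0_le_continuum (mk_entries_lt hD)
      ((hAc.union hBc).le_aleph0.trans_lt Cardinal.aleph0_lt_continuum)
  obtain ⟨x, y, n, hx, -, h⟩ := exists_genericApproach hFc
  -- The input `codePair searchProgram [x, z]` as functions of `z`; its constant part is eventually
  -- rational because the code was put into `F`.
  set fs : List (ℝ → ℝ) :=
    (Program.code searchProgram).map (fun r _ => r) ++ [fun _ => x, fun z => z] with hfs
  have hmap : ∀ z, fs.map (fun f => f z) = codePair searchProgram [x, z] := by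
    intro z
    simp [hfs, codePair, Function.comp_def]
  have hrat : ∀ f ∈ fs, EventuallyRational F x y n f := by
    intro f hf
    rw [hfs, List.mem_append, List.mem_map] at hf
    rcases hf with ⟨r, hr, rfl⟩ | hf
    · exact GenericApproach.eventuallyRational_const
        (Subfield.subset_closure (.inr (.inr hr)))
    · simp only [List.mem_cons, List.not_mem_nil, or_false] at hf
      rcases hf with rfl | rfl
      · exact GenericApproach.eventuallyRational_left
      · exact GenericApproach.eventuallyRational_id
  have hout := (hP (codePair searchProgram [x, y])).2 fun hm =>
    h.not_halts_searchProgram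
      ((codePair_mem_haltingProblem_iff searchProgram_isOracleFree).1 hm)
  rw [← hmap] at hout
  have hev := h.eventually_outputs
    (fun v hv r hr => Subfield.subset_closure (.inl ⟨v, hv, hr⟩)) hCD
    (fun i r hr => Subfield.subset_closure (.inr (.inl ⟨i, hr⟩))) hrat F.zero_mem hout
  -- At some approximating point the decider still outputs `0`, while `searchProgram` halts there
  -- and the output has to be `1`.
  obtain ⟨k, hk⟩ := (eventually_approachFilter.1 hev).2.exists
  rw [hmap] at hk
  have hone := (hP (codePair searchProgram [x, n k * x ^ k])).1
    ((codePair_mem_haltingProblem_iff searchProgram_isOracleFree).2 (halts_searchProgram hx _ _))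
  simpa using hk.unique hone

theorem mk_eq_two_power_aleph0_of_not_lt {S : Set Tuple}
    (hS : ¬ Cardinal.mk S < Cardinal.continuum) :
    Cardinal.mk S = 2 ^ Cardinal.aleph0 := by
  rw [Cardinal.two_power_aleph0]
  refine le_antisymm ((Cardinal.mk_set_le S).trans ?_) (not_lt.1 hS)
  rw [Cardinal.mk_list_eq_mk, Cardinal.mk_real]

theorem countable_algebraicReals : algebraicReals.Countable := by
  refine ((Algebraic.countable ℚ ℝ).image fun a => [a]).mono ?_
  rintro v ⟨a, ha, rfl⟩
  exact ⟨a, ha, rfl⟩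

theorem not_reducible_haltingProblem_of_countable {C : Set Tuple} (hC : C.Countable) :
    ¬ Reducible haltingProblem C :=
  not_reducible_haltingProblem (hC.le_aleph0.trans_lt Cardinal.aleph0_lt_continuum)
    fun _ _ _ h => h

end BSS

theorem theorem3p1 :
    (∀ C : Set BSS.Tuple, BSS.Reducible BSS.haltingProblem C →
      Cardinal.mk C = 2 ^ Cardinal.aleph0 ∧
      Cardinal.mk (Cᶜ : Set BSS.Tuple) = 2 ^ Cardinal.aleph0 ∧
      ∀ m : ℕ, C ⊆ {v : BSS.Tuple | v.length = m} →
        Cardinal.mk ({v : BSS.Tuple | v.length = m} \ C : Set BSS.Tuple) =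
          2 ^ Cardinal.aleph0) ∧
    (∀ C : Set BSS.Tuple, C.Countable → ¬ BSS.Reducible BSS.haltingProblem C) ∧
    ¬ BSS.Reducible BSS.haltingProblem BSS.algebraicReals := by
  refine ⟨fun C hC => ⟨?_, ?_, fun m hm => ?_⟩,
    fun C hC => BSS.not_reducible_haltingProblem_of_countable hC,
    BSS.not_reducible_haltingProblem_of_countable BSS.countable_algebraicReals⟩
  · exact BSS.mk_eq_two_power_aleph0_of_not_lt fun hlt =>
      BSS.not_reducible_haltingProblem hlt (fun _ _ _ h => h) hC
  · exact BSS.mk_eq_two_power_aleph0_of_not_lt fun hlt =>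
      BSS.not_reducible_haltingProblem hlt (fun _ _ _ h => not_iff_not.1 h) hC
  -- Here `D` is the complement within length `m`. It determines `C` only among tuples of that
  -- length; all others lie outside `C`, which is why the criterion compares tuples of equal length.
  · refine BSS.mk_eq_two_power_aleph0_of_not_lt fun hlt =>
      BSS.not_reducible_haltingProblem hlt (fun v w hl h => ?_) hC
    by_cases hv : v.length = m
    · simp only [Set.mem_sdiff, Set.mem_ofPred_eq, hv, ← hl, true_and] at h
      exact not_iff_not.1 h
    · exact iff_of_false (fun hvC => hv (hm hvC)) fun hwC => hv (hl.trans (hm hwC))
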